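/- Let $\Bbbk$ be a field of characteristic $0$, let $S=\Bbbk[x_1,\dots,x_n]$ with its standard grading, and let $\Delta$ be a simplicial complex on the vertex set $[n]=\{1,\dots,n\}$ (every vertex being a face). For $i\ge 0$ let $K_i^\Delta$ be the free graded $S$-module with basis the exterior monomials $v_\sigma=v_{j_1}\wedge\cdots\wedge v_{j_i}$ of degree $i$, one for each $\sigma=\{j_1<\cdots<j_i\}$ which is a face of $\Delta$ or empty, with the Koszul differential $\partial(v_{j_1}\wedge\cdots\wedge v_{j_i})=\sum_{l=1}^{i}(-1)^{l-1}x_{j_l}\,v_{j_1}\wedge\cdots\wedge\widehat{v_{j_l}}\wedge\cdots\wedge v_{j_i}$, and let $W_i(\Delta)=H_i(K_\bullet^\Delta,\partial)$ be the $i$-th Koszul module of $\Delta$, a finitely generated graded $S$-module. For such a module $M$ with minimal graded free resolution $F_\bullet$, $F_i=\bigoplus_t S(-a_{i,t})$, let $\operatorname{reg} M=\sup_{i,t}(a_{i,t}-i)$ be its Castelnuovo–Mumford regularity (so $\operatorname{reg} 0=-\infty$). (1) Let $1\le d\le n-3$, and suppose that $\Delta$ has dimension $d$ and that its $(d-1)$-skeleton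 is that of the full simplex, i.e. every nonempty set of at most $d$ vertices is a face. Then $\operatorname{reg} W_d(\Delta)\le n-2$. (2) Let $n\ge 4$, and let $\Gamma$ be a simple graph on the vertex set $[n]$, regarded as a simplicial complex of dimension at most $1$ whose faces are the vertices and the edges. Then $\operatorname{reg}\bigl(W_1(\Gamma)(2)\bigr)\le n-4$, where $M(2)_j=M_{j+2}$. -/

import Mathlib

open MvPolynomial

noncomputable section

namespace KoszulSimplicial

/-! ### Graded free modules and Castelnuovo–Mumford regularity over a polynomial ring -/

/-- The degree `j` part of the graded free module `⨁ₜ S(-a t)` over `S = k[x₁, …, xₙ]`, whose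
`t`-th basis vector has degree `a t`: the vectors whose `t`-th entry is a homogeneous polynomial
of degree `j - a t` (so the entry is zero if `j < a t`). -/
def gradedFree {k : Type*} [Field k] {n : ℕ} {ι : Type*} (a : ι → ℤ) (j : ℤ) :
    Submodule k (ι → MvPolynomial (Fin n) k) where
  carrier := {f | ∀ t, ∀ m ∈ (f t).support, (m.degree : ℤ) + a t = j}
  zero_mem' := by
    intro t m hm
    simp at hm
  add_mem' := by
    classical
    intro f g hf hg t m hm
    rcases Finset.mem_union.1 (support_add hm) with h | h
    · exact hf t m h
    · exact hg t m h
  smul_mem' := by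
    intro c f hf t m hm
    exact hf t m (support_smul hm)

/-- A minimal graded free resolution
`⋯ → F₂ → F₁ → F₀ → M → 0` of an `S`-module `M` graded by the subspaces `grading j`, `j ∈ ℤ`.
Each `Fᵢ = ⨁ₜ S(-deg i t)` is graded free of finite rank, all maps are homogeneous of degree
zero, the sequence is exact, and the image of `Fᵢ₊₁` is contained in `(x₁, …, xₙ) Fᵢ`. -/
structure MinimalGradedFreeResolution {k : Type*} [Field k] (n : ℕ) {M : Type*} [AddCommGroup M]
    [Module k M] [Module (MvPolynomial (Fin n) k) M] [IsScalarTower k (MvPolynomial (Fin n) k) M]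
    (grading : ℤ → Submodule k M) where
  rank : ℕ → ℕ
  deg : (i : ℕ) → Fin (rank i) → ℤ
  d : (i : ℕ) → (Fin (rank (i + 1)) → MvPolynomial (Fin n) k) →ₗ[MvPolynomial (Fin n) k]
    (Fin (rank i) → MvPolynomial (Fin n) k)
  aug : (Fin (rank 0) → MvPolynomial (Fin n) k) →ₗ[MvPolynomial (Fin n) k] M
  d_homogeneous : ∀ (i : ℕ) (j : ℤ), ∀ f ∈ gradedFree (k := k) (deg (i + 1)) j,
    d i f ∈ gradedFree (k := k) (deg i) j
  aug_homogeneous : ∀ j : ℤ, ∀ f ∈ gradedFree (k := k) (deg 0) j, aug f ∈ grading j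
  aug_surjective : Function.Surjective aug
  exact_zero : Function.Exact (d 0) aug
  exact_succ : ∀ i : ℕ, Function.Exact (d (i + 1)) (d i)
  minimal : ∀ i : ℕ, LinearMap.range (d i) ≤
    (idealOfVars (Fin n) k) • (⊤ : Submodule (MvPolynomial (Fin n) k)
      (Fin (rank i) → MvPolynomial (Fin n) k))

/-- The Castelnuovo–Mumford regularity of a graded `S`-module: the supremum of `deg i t - i` over
the degrees `deg i t` of the generators of the `i`-th term of the minimal graded free resolution.
The minimal resolution is unique up to isomorphism, so the infimum over all of them only picks it;
it is `⊤` if there is none (which does not happen for finitely generated graded modules).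
The zero module has regularity `⊥ = -∞`. -/
def regularity {k : Type*} [Field k] (n : ℕ) {M : Type*} [AddCommGroup M]
    [Module k M] [Module (MvPolynomial (Fin n) k) M] [IsScalarTower k (MvPolynomial (Fin n) k) M]
    (grading : ℤ → Submodule k M) : EReal :=
  ⨅ F : MinimalGradedFreeResolution n grading, ⨆ (i : ℕ) (t : Fin (F.rank i)),
    (((F.deg i t - (i : ℤ) : ℤ) : ℝ) : EReal)

/-- The grading of the shifted module `M(s)`, namely `M(s)ⱼ = M_{s+j}`. -/
def shift {k : Type*} [Field k] {M : Type*} [AddCommGroup M] [Module k M]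
    (grading : ℤ → Submodule k M) (s : ℤ) : ℤ → Submodule k M :=
  fun j => grading (s + j)

/-! ### The Koszul complex of a simplicial complex -/

/-- The simplices of `Δ` with exactly `i` vertices, the empty simplex included (for `i = 0`;
Mathlib does not list the empty simplex among the faces). -/
abbrev Simplex {n : ℕ} (Δ : AbstractSimplicialComplex (Fin n)) (i : ℕ) : Type :=
  {σ : Finset (Fin n) // (σ = ∅ ∨ σ ∈ Δ) ∧ σ.card = i}

instance {n : ℕ} (Δ : AbstractSimplicialComplex (Fin n)) (i : ℕ) : Fintype (Simplex Δ i) :=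
  Fintype.ofFinite _

/-- The simplex obtained by deleting the vertex `v`. -/
def Simplex.erase {n : ℕ} {Δ : AbstractSimplicialComplex (Fin n)} {i : ℕ}
    (σ : Simplex Δ (i + 1)) (v : Fin n) (hv : v ∈ σ.1) : Simplex Δ i :=
  ⟨σ.1.erase v, by
    refine ⟨?_, by rw [Finset.card_erase_of_mem hv, σ.2.2]; rfl⟩
    rcases Finset.eq_empty_or_nonempty (σ.1.erase v) with h | h
    · exact Or.inl h
    · rcases σ.2.1 with h0 | h1
      · rw [h0] at hv
        simp at hv
      · exact Or.inr ((Δ.isRelLowerSet_faces h1).2 (Finset.erase_subset v σ.1) h)⟩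

/-- The free `S`-module `K_i` spanned by the exterior monomials
`v_σ = v_{j₁} ∧ ⋯ ∧ v_{jᵢ}`, `j₁ < ⋯ < jᵢ`, where `σ = {j₁, …, jᵢ}` is a simplex of `Δ`. An
element is given by its coordinates; `v_σ` is `Pi.single σ 1`. -/
abbrev KoszulChain (k : Type*) [Field k] {n : ℕ} (Δ : AbstractSimplicialComplex (Fin n)) (i : ℕ) :
    Type _ :=
  Simplex Δ i → MvPolynomial (Fin n) k

/-- The Koszul differential `∂ : K_{i+1} → K_i`, the `S`-linear map with
`∂ (v_{j₀} ∧ ⋯ ∧ v_{jᵢ}) = ∑ₗ (-1)ˡ x_{jₗ} • v_{j₀} ∧ ⋯ ∧ v̂_{jₗ} ∧ ⋯ ∧ v_{jᵢ}`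
for `j₀ < ⋯ < jᵢ`; the sign of the vertex `v` is given by the number of smaller vertices. -/
def koszulD (k : Type*) [Field k] {n : ℕ} (Δ : AbstractSimplicialComplex (Fin n)) (i : ℕ) :
    KoszulChain k Δ (i + 1) →ₗ[MvPolynomial (Fin n) k] KoszulChain k Δ i :=
  Fintype.linearCombination (MvPolynomial (Fin n) k) fun σ : Simplex Δ (i + 1) =>
    ∑ v : {v // v ∈ σ.1},
      ((-1) ^ (σ.1.filter (· < v.1)).card * X v.1 : MvPolynomial (Fin n) k) •
        (Pi.single (σ.erase v.1 v.2) 1 : KoszulChain k Δ i)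

theorem koszulD_single (k : Type*) [Field k] {n : ℕ} (Δ : AbstractSimplicialComplex (Fin n))
    (i : ℕ) (σ : Simplex Δ (i + 1)) :
    koszulD k Δ i (Pi.single σ 1) = ∑ v : {v // v ∈ σ.1},
      ((-1) ^ (σ.1.filter (· < v.1)).card * X v.1 : MvPolynomial (Fin n) k) •
        (Pi.single (σ.erase v.1 v.2) 1 : KoszulChain k Δ i) := by
  rw [koszulD, Fintype.linearCombination_apply_single, one_smul]

theorem koszul_sign {n : ℕ} (σ : Finset (Fin n)) {v w : Fin n} (hw : w ∈ σ) (h : w < v) :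
    (σ.filter (· < v)).card + ((σ.erase v).filter (· < w)).card =
      (σ.filter (· < w)).card + ((σ.erase w).filter (· < v)).card + 1 := by
  have h1 : (σ.erase v).filter (· < w) = σ.filter (· < w) := by
    ext a
    simp only [Finset.mem_filter, Finset.mem_erase]
    grind
  have h2 : (σ.erase w).filter (· < v) = (σ.filter (· < v)).erase w := by
    ext a
    simp only [Finset.mem_filter, Finset.mem_erase]
    grind
  have h3 : w ∈ σ.filter (· < v) := by simp [hw, h]
  have h4 := Finset.card_erase_add_one h3
  rw [h1, h2]
  omega

theorem koszulD_koszulD (k : Type*) [Field k] {n : ℕ} (Δ : AbstractSimplicialComplex (Fin n))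
    (i : ℕ) : koszulD k Δ i ∘ₗ koszulD k Δ (i + 1) = 0 := by
  refine LinearMap.pi_ext' fun σ => LinearMap.ext_ring ?_
  simp only [LinearMap.comp_apply, LinearMap.coe_single, koszulD_single, map_sum, map_smul,
    Finset.smul_sum, LinearMap.zero_apply]
  rw [← Finset.sum_sigma Finset.univ (fun _ => Finset.univ)
    (fun p : (v : {v // v ∈ σ.1}) × {w // w ∈ (σ.erase v.1 v.2).1} =>
      ((-1) ^ (σ.1.filter (· < p.1.1)).card * X p.1.1 : MvPolynomial (Fin n) k) •
      ((-1) ^ ((σ.erase p.1.1 p.1.2).1.filter (· < p.2.1)).card * X p.2.1 :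
        MvPolynomial (Fin n) k) •
        (Pi.single ((σ.erase p.1.1 p.1.2).erase p.2.1 p.2.2) 1 : KoszulChain k Δ i))]
  refine Finset.sum_involution
    (fun p _ => ⟨⟨p.2.1, (Finset.mem_erase.1 p.2.2).2⟩, ⟨p.1.1, Finset.mem_erase.2
      ⟨(Finset.mem_erase.1 p.2.2).1.symm, p.1.2⟩⟩⟩) ?_ ?_ ?_ ?_
  · rintro ⟨⟨v, hv⟩, ⟨w, hw⟩⟩ -
    have hw' := Finset.mem_erase.1 hw
    have he : (σ.erase v hv).erase w hw = (σ.erase w hw'.2).erase v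
        (Finset.mem_erase.2 ⟨hw'.1.symm, hv⟩) := Subtype.ext (Finset.erase_right_comm)
    have key : ((-1) ^ ((σ.1.filter (· < v)).card + ((σ.1.erase v).filter (· < w)).card) :
        MvPolynomial (Fin n) k) =
        - (-1) ^ ((σ.1.filter (· < w)).card + ((σ.1.erase w).filter (· < v)).card) := by
      rcases lt_or_gt_of_ne hw'.1 with h | h
      · rw [koszul_sign σ.1 hw'.2 h, pow_succ]
        ring
      · rw [koszul_sign σ.1 hv h, pow_succ]
        ring
    simp only [he, smul_smul, ← add_smul]
    rw [pow_add, pow_add] at key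
    convert zero_smul (MvPolynomial (Fin n) k) _ using 2
    simp only [Simplex.erase]
    linear_combination (X v * X w) * key
  · rintro ⟨⟨v, hv⟩, ⟨w, hw⟩⟩ - - h
    have hw' := Finset.mem_erase.1 hw
    exact hw'.1 (congrArg (fun p => p.1.1) h)
  · intro p _
    simp
  · intro p _
    rfl

/-- The cycles `Z_i ⊆ K_i` of the Koszul complex of `Δ` (which is zero in negative degrees). -/
def koszulCycles (k : Type*) [Field k] {n : ℕ} (Δ : AbstractSimplicialComplex (Fin n)) :
    (i : ℕ) → Submodule (MvPolynomial (Fin n) k) (KoszulChain k Δ i)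
  | 0 => ⊤
  | i + 1 => LinearMap.ker (koszulD k Δ i)

/-- The boundaries are cycles. -/
theorem range_koszulD_le (k : Type*) [Field k] {n : ℕ} (Δ : AbstractSimplicialComplex (Fin n))
    (i : ℕ) : LinearMap.range (koszulD k Δ i) ≤ koszulCycles k Δ i := by
  cases i with
  | zero => exact le_top
  | succ i =>
    rintro _ ⟨f, rfl⟩
    exact LinearMap.congr_fun (koszulD_koszulD k Δ i) f

/-- The Koszul module `W_i(Δ)`, the `i`-th homology module of the Koszul complex of `Δ`. -/
abbrev KoszulModule (k : Type*) [Field k] {n : ℕ} (Δ : AbstractSimplicialComplex (Fin n)) (i : ℕ) :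
    Type _ :=
  koszulCycles k Δ i ⧸ (LinearMap.range (koszulD k Δ i)).submoduleOf (koszulCycles k Δ i)

/-- The grading of `W_i(Δ)`: since every `v_j` and every `x_j` has degree one, the basis vectors
`v_σ` of `K_i` have degree `i`, and `W_i(Δ)ⱼ` consists of the classes of the cycles of degree `j`
in `K_i`. -/
def koszulGrading (k : Type*) [Field k] {n : ℕ} (Δ : AbstractSimplicialComplex (Fin n)) (i : ℕ)
    (j : ℤ) : Submodule k (KoszulModule k Δ i) :=
  ((gradedFree (fun _ : Simplex Δ i => (i : ℤ)) j).comap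
      ((koszulCycles k Δ i).subtype.restrictScalars k)).map
    (((LinearMap.range (koszulD k Δ i)).submoduleOf (koszulCycles k Δ i)).mkQ.restrictScalars k)

/-! ### The complexes considered -/

/-- `Δ` has dimension `d`: the largest faces have `d + 1` vertices. -/
def HasDimension {n : ℕ} (Δ : AbstractSimplicialComplex (Fin n)) (d : ℕ) : Prop :=
  (∃ σ ∈ Δ, σ.card = d + 1) ∧ ∀ σ ∈ Δ, σ.card ≤ d + 1

/-- The `(d-1)`-skeleton of `Δ` is that of the full simplex: every nonempty set of at most `d`
vertices is a face. -/
def HasCompleteSkeleton {n : ℕ} (Δ : AbstractSimplicialComplex (Fin n)) (d : ℕ) : Prop :=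
  ∀ σ : Finset (Fin n), σ.Nonempty → σ.card ≤ d → σ ∈ Δ

/-- A graph viewed as a simplicial complex of dimension at most one: its faces are the vertices
and the edges. -/
def graphComplex {n : ℕ} (Γ : SimpleGraph (Fin n)) : AbstractSimplicialComplex (Fin n) where
  faces := {σ | (∃ v, σ = {v}) ∨ ∃ v w, Γ.Adj v w ∧ σ = {v, w}}
  isRelLowerSet_faces := by
    rintro σ hσ
    refine ⟨?_, ?_⟩
    · rcases hσ with ⟨v, rfl⟩ | ⟨v, w, -, rfl⟩ <;> simp
    · intro τ hτ hne
      rcases hσ with ⟨v, rfl⟩ | ⟨v, w, h, rfl⟩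
      · exact Or.inl ⟨v, (Finset.Nonempty.subset_singleton_iff hne).1 hτ⟩
      · by_cases hv : v ∈ τ
        · by_cases hw : w ∈ τ
          · refine Or.inr ⟨v, w, h, Finset.Subset.antisymm hτ ?_⟩
            intro a ha
            rcases Finset.mem_insert.1 ha with rfl | ha
            · exact hv
            · rw [Finset.mem_singleton.1 ha]
              exact hw
          · refine Or.inl ⟨v, (Finset.Nonempty.subset_singleton_iff hne).1 ?_⟩
            intro a ha
            have := hτ ha
            grind
        · refine Or.inl ⟨w, (Finset.Nonempty.subset_singleton_iff hne).1 ?_⟩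
          intro a ha
          have := hτ ha
          grind
  singleton_mem v := Or.inl ⟨v, rfl⟩

end KoszulSimplicial

end

/-! Put `d = i + 1`. All sets of `i + 1` vertices are simplices, so `Δ` and the full simplex have
the same Koszul chains in degree `i + 1`. The full Koszul complex is exact there
(`exists_fullD_eq`), so a cycle of `Δ` is the boundary of a chain on `(i + 2)`-sets. The part of
that chain on faces contributes only a boundary of `Δ`. Hence `W_{i+1}(Δ)` is generated by the
classes of `∂ v_ρ` for the missing faces `ρ` with `i + 2` vertices. By exactness one degree higher,
its relations are generated by the `∂ v_π`, `|π| = i + 3`, restricted to the missing faces.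

This presentation is graded by exponent vectors, with squarefree shifts. Kernels of such maps are
again generated in squarefree multidegrees (`IsMultigraded.ker_eq_span`), so choosing minimal
generators repeatedly gives a minimal resolution in which every shift is the size of a subset of
`[n]`, hence at most `n`. From the second syzygies on, shift minus homological index is therefore at
most `n - 2`. The generators contribute `i + 2` and the relations `(i + 3) - 1`, both at most `n -
2` because `i + 4 ≤ n`. Both claims are instances of `regularity_koszulModule_le`, the second with
`i = 0` and a shift by `2`. -/

noncomputable section

namespace KoszulSimplicial

/-! ### Multigraded free modules, squarefree syzygies and minimal generators -/

section Multigraded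

variable {k : Type*} [Field k] {n : ℕ} {ι κ : Type*}

/-- The exponent vector of the squarefree monomial with support `σ`. -/
def squarefreeExp (σ : Finset (Fin n)) : Fin n →₀ ℕ := Finsupp.indicator σ fun _ _ => 1

theorem squarefreeExp_apply (σ : Finset (Fin n)) (v : Fin n) :
    squarefreeExp σ v = if v ∈ σ then 1 else 0 := by
  simp [squarefreeExp, Finsupp.indicator_apply]

theorem degree_squarefreeExp (σ : Finset (Fin n)) : (squarefreeExp σ).degree = σ.card := by
  simp [Finsupp.degree_eq_sum, squarefreeExp_apply]

theorem squarefreeExp_insert {σ : Finset (Fin n)} {v : Fin n} (hv : v ∉ σ) :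
    squarefreeExp (insert v σ) = Finsupp.single v 1 + squarefreeExp σ := by
  ext w
  by_cases h : v = w
  · subst h
    simp [squarefreeExp_apply, hv]
  · simp [squarefreeExp_apply, Ne.symm h]

/-- Divisibility by a squarefree monomial depends only on the support of `a`; this is what lets
syzygies be reduced to squarefree multidegrees. -/
theorem squarefreeExp_le_iff {σ : Finset (Fin n)} {a : Fin n →₀ ℕ} :
    squarefreeExp σ ≤ a ↔ σ ⊆ a.support := by
  rw [Finsupp.le_def]
  refine forall_congr' fun v => ?_
  by_cases h : v ∈ σ <;> simp [squarefreeExp_apply, h, Nat.one_le_iff_ne_zero]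

/-- The vector `f` of the free module `⨁ₜ S(-s t)` is homogeneous of multidegree `a`. -/
def IsMultihomogeneous (s : ι → Fin n →₀ ℕ) (a : Fin n →₀ ℕ) (f : ι → MvPolynomial (Fin n) k) :
    Prop :=
  ∀ t, ∀ m ∈ (f t).support, m + s t = a

open Classical in
/-- The component of multidegree `a` of a vector of the free module `⨁ₜ S(-s t)`. -/
def multiComponent (s : ι → Fin n →₀ ℕ) (a : Fin n →₀ ℕ) (f : ι → MvPolynomial (Fin n) k) :
    ι → MvPolynomial (Fin n) k :=
  fun t => if s t ≤ a then monomial (a - s t) (coeff (a - s t) (f t)) else 0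

theorem coeff_multiComponent (s : ι → Fin n →₀ ℕ) (a m : Fin n →₀ ℕ)
    (f : ι → MvPolynomial (Fin n) k) (t : ι) :
    coeff m (multiComponent s a f t) = if m + s t = a then coeff m (f t) else 0 := by
  classical
  unfold multiComponent
  by_cases h : m + s t = a
  · subst h
    simp
  · rw [if_neg h]
    split_ifs with h2
    · rw [coeff_monomial, if_neg]
      rintro rfl
      exact h (tsub_add_cancel_of_le h2)
    · simp

theorem isMultihomogeneous_multiComponent (s : ι → Fin n →₀ ℕ) (a : Fin n →₀ ℕ)
    (f : ι → MvPolynomial (Fin n) k) : IsMultihomogeneous s a (multiComponent s a f) := by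
  intro t m hm
  rw [mem_support_iff, coeff_multiComponent] at hm
  by_contra h
  exact hm (if_neg h)

theorem IsMultihomogeneous.multiComponent_eq {s : ι → Fin n →₀ ℕ} {b : Fin n →₀ ℕ}
    {f : ι → MvPolynomial (Fin n) k} (hf : IsMultihomogeneous s b f) (a : Fin n →₀ ℕ) :
    multiComponent s a f = if b = a then f else 0 := by
  classical
  funext t
  ext m
  rw [coeff_multiComponent]
  by_cases h0 : coeff m (f t) = 0
  · split_ifs <;> simp [h0]
  · rw [hf t m (mem_support_iff.2 h0)]
    split_ifs <;> simp

theorem multiComponent_sum (s : ι → Fin n →₀ ℕ) (a : Fin n →₀ ℕ) {α : Type*} (A : Finset α)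
    (f : α → ι → MvPolynomial (Fin n) k) :
    multiComponent s a (∑ b ∈ A, f b) = ∑ b ∈ A, multiComponent s a (f b) := by
  funext t
  ext m
  simp only [coeff_multiComponent, Finset.sum_apply, coeff_sum]
  split_ifs <;> simp

theorem exists_sum_multiComponent [Finite ι] (s : ι → Fin n →₀ ℕ)
    (f : ι → MvPolynomial (Fin n) k) :
    ∃ A : Finset (Fin n →₀ ℕ), (∀ a ∉ A, multiComponent s a f = 0) ∧
      f = ∑ a ∈ A, multiComponent s a f := by
  classical
  have := Fintype.ofFinite ι
  have hA : ∀ t m, coeff m (f t) ≠ 0 →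
      m + s t ∈ Finset.univ.biUnion fun t => (f t).support.image (· + s t) := by
    intro t m h
    exact Finset.mem_biUnion.2 ⟨t, Finset.mem_univ _, Finset.mem_image_of_mem _
      (mem_support_iff.2 h)⟩
  refine ⟨Finset.univ.biUnion fun t => (f t).support.image (· + s t), ?_, ?_⟩
  · intro a ha
    funext t
    ext m
    rw [coeff_multiComponent]
    split_ifs with h
    · by_contra h0
      exact ha (h ▸ hA t m h0)
    · simp
  · funext t
    ext m
    simp only [Finset.sum_apply, coeff_sum, coeff_multiComponent, Finset.sum_ite_eq]
    split_ifs with h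
    · rfl
    · by_contra h0
      exact h (hA t m h0)

theorem mem_of_multiComponent_mem [Finite ι] (s : ι → Fin n →₀ ℕ)
    {N : Submodule (MvPolynomial (Fin n) k) (ι → MvPolynomial (Fin n) k)}
    {f : ι → MvPolynomial (Fin n) k} (h : ∀ a, multiComponent s a f ∈ N) : f ∈ N := by
  obtain ⟨A, -, hA⟩ := exists_sum_multiComponent s f
  rw [hA]
  exact Submodule.sum_mem _ fun a _ => h a

/-- An `S`-linear map that maps each basis vector to a vector of the same degree preserves
degrees. -/
theorem map_homogeneous [Fintype ι] [DecidableEq ι] {A : Type*} [AddCommMonoid A]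
    (w : (Fin n →₀ ℕ) →+ A) {s : ι → A} {s' : κ → A}
    {φ : (ι → MvPolynomial (Fin n) k) →ₗ[MvPolynomial (Fin n) k] (κ → MvPolynomial (Fin n) k)}
    (hφ : ∀ t u, ∀ m ∈ (φ (Pi.single t 1) u).support, w m + s' u = s t) {a : A}
    {f : ι → MvPolynomial (Fin n) k} (hf : ∀ t, ∀ m ∈ (f t).support, w m + s t = a) :
    ∀ u, ∀ m ∈ (φ f u).support, w m + s' u = a := by
  classical
  intro u m hm
  rw [LinearMap.pi_apply_eq_sum_univ φ f, Finset.sum_apply] at hm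
  obtain ⟨t, -, ht⟩ := Finset.mem_biUnion.1 (support_sum hm)
  obtain ⟨m₁, h₁, m₂, h₂, rfl⟩ := Finset.mem_add.1 (support_mul _ _ ht)
  have e : (fun j => if t = j then (1 : MvPolynomial (Fin n) k) else 0) = Pi.single t 1 := by
    funext j
    simp [Pi.single_apply, eq_comm]
  rw [e] at h₂
  rw [map_add, add_assoc, hφ t u m₂ h₂, hf t m₁ h₁]

/-- An `S`-linear map of free modules is multigraded if it maps each basis vector to a vector of
the same multidegree. -/
def IsMultigraded [DecidableEq ι] (s : ι → Fin n →₀ ℕ) (s' : κ → Fin n →₀ ℕ)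
    (φ : (ι → MvPolynomial (Fin n) k) →ₗ[MvPolynomial (Fin n) k] (κ → MvPolynomial (Fin n) k)) :
    Prop :=
  ∀ t, IsMultihomogeneous s' (s t) (φ (Pi.single t 1))

theorem IsMultigraded.isMultihomogeneous [Fintype ι] [DecidableEq ι] {s : ι → Fin n →₀ ℕ}
    {s' : κ → Fin n →₀ ℕ}
    {φ : (ι → MvPolynomial (Fin n) k) →ₗ[MvPolynomial (Fin n) k] (κ → MvPolynomial (Fin n) k)}
    (hφ : IsMultigraded s s' φ) {a : Fin n →₀ ℕ} {f : ι → MvPolynomial (Fin n) k}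
    (hf : IsMultihomogeneous s a f) : IsMultihomogeneous s' a (φ f) :=
  map_homogeneous (AddMonoidHom.id _) hφ hf

theorem IsMultigraded.map_multiComponent [Fintype ι] [DecidableEq ι] {s : ι → Fin n →₀ ℕ}
    {s' : κ → Fin n →₀ ℕ}
    {φ : (ι → MvPolynomial (Fin n) k) →ₗ[MvPolynomial (Fin n) k] (κ → MvPolynomial (Fin n) k)}
    (hφ : IsMultigraded s s' φ) (a : Fin n →₀ ℕ) (f : ι → MvPolynomial (Fin n) k) :
    φ (multiComponent s a f) = multiComponent s' a (φ f) := by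
  classical
  obtain ⟨A, h0, hA⟩ := exists_sum_multiComponent s f
  conv_rhs => rw [hA, map_sum, multiComponent_sum]
  simp only [(hφ.isMultihomogeneous (isMultihomogeneous_multiComponent s _ f)).multiComponent_eq,
    Finset.sum_ite_eq']
  split_ifs with h
  · rfl
  · rw [h0 a h, map_zero]

/-- A multigraded map of free modules with squarefree shifts preserves total degrees. -/
theorem IsMultigraded.map_mem_gradedFree [Fintype ι] [DecidableEq ι] {s : ι → Finset (Fin n)}
    {s' : κ → Finset (Fin n)}
    {φ : (ι → MvPolynomial (Fin n) k) →ₗ[MvPolynomial (Fin n) k] (κ → MvPolynomial (Fin n) k)}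
    (hφ : IsMultigraded (fun t => squarefreeExp (s t)) (fun u => squarefreeExp (s' u)) φ) (c j : ℤ)
    {f : ι → MvPolynomial (Fin n) k}
    (hf : f ∈ gradedFree (k := k) (fun t => ((s t).card : ℤ) - c) j) :
    φ f ∈ gradedFree (k := k) (fun u => ((s' u).card : ℤ) - c) j := by
  refine map_homogeneous ((Nat.castAddMonoidHom ℤ).comp Finsupp.degree) ?_ hf
  intro t u m hm
  have := congrArg (fun a : Fin n →₀ ℕ => ((Finsupp.degree a : ℕ) : ℤ)) (hφ t u m hm)
  simp only [map_add, degree_squarefreeExp, Nat.cast_add] at this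
  simp only [AddMonoidHom.comp_apply, Nat.coe_castAddMonoidHom]
  change ((Finsupp.degree m : ℕ) : ℤ) + _ = _
  linarith

/-- The kernel of a multigraded map of free modules with squarefree shifts is generated by elements
of squarefree multidegree. -/
theorem IsMultigraded.ker_eq_span [Fintype ι] [DecidableEq ι] {s : ι → Finset (Fin n)}
    {s' : κ → Fin n →₀ ℕ}
    {φ : (ι → MvPolynomial (Fin n) k) →ₗ[MvPolynomial (Fin n) k] (κ → MvPolynomial (Fin n) k)}
    (hφ : IsMultigraded (fun t => squarefreeExp (s t)) s' φ) :
    LinearMap.ker φ = Submodule.span (MvPolynomial (Fin n) k)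
      {f | φ f = 0 ∧ ∃ τ, IsMultihomogeneous (fun t => squarefreeExp (s t)) (squarefreeExp τ) f} := by
  classical
  refine le_antisymm ?_ (Submodule.span_le.2 fun f hf => hf.1)
  intro f hf
  refine mem_of_multiComponent_mem (fun t => squarefreeExp (s t)) fun a => ?_
  set τ := a.support with hτ
  have hτa : squarefreeExp τ ≤ a := squarefreeExp_le_iff.2 subset_rfl
  -- Only basis vectors with `s t ⊆ τ` occur in multidegree `a`, so the monomial of exponent `a -
  -- squarefreeExp τ` divides the whole component; `g` is the quotient, of multidegree `τ`.
  let g : ι → MvPolynomial (Fin n) k := fun t =>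
    if s t ⊆ τ then monomial (squarefreeExp τ - squarefreeExp (s t))
      (coeff (a - squarefreeExp (s t)) (f t)) else 0
  have hsub : ∀ t, s t ⊆ τ → squarefreeExp (s t) ≤ squarefreeExp τ := by
    intro t h v
    have := @h v
    simp only [squarefreeExp_apply]
    grind
  have hg : multiComponent (fun t => squarefreeExp (s t)) a f =
      (monomial (a - squarefreeExp τ) 1 : MvPolynomial (Fin n) k) • g := by
    funext t
    simp only [multiComponent, squarefreeExp_le_iff, Pi.smul_apply, smul_eq_mul, g, ← hτ]
    split_ifs with h
    · rw [monomial_mul, one_mul, tsub_add_tsub_cancel hτa (hsub t h)]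
    · simp
  rw [hg]
  refine Submodule.smul_mem _ _ (Submodule.subset_span ⟨?_, τ, ?_⟩)
  · have h1 := hφ.map_multiComponent a f
    rw [LinearMap.mem_ker.1 hf, hg, map_smul] at h1
    have h2 : multiComponent s' a (0 : κ → MvPolynomial (Fin n) k) = 0 := by
      funext u
      simp [multiComponent]
    rw [h2] at h1
    -- The target is torsion-free, so the monomial factor cancels and `g` is itself a syzygy.
    exact (smul_eq_zero.1 h1).resolve_left (by simp [monomial_eq_zero])
  · intro t m hm
    simp only [g] at hm
    split_ifs at hm with h
    · rw [Finset.mem_singleton.1 (support_monomial_subset hm)]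
      exact tsub_add_cancel_of_le (hsub t h)
    · simp at hm

theorem mem_idealOfVars_of_coeff_zero {f : MvPolynomial (Fin n) k} (h : coeff 0 f = 0) :
    f ∈ idealOfVars (Fin n) k := by
  rw [idealOfVars, ← Set.image_univ, mem_ideal_span_X_image]
  intro m hm
  by_contra! h0
  have : m = 0 := by
    ext v
    simpa using h0 v
  subst this
  exact mem_support_iff.1 hm h

theorem mem_idealOfVars_smul_top [Fintype ι] {f : ι → MvPolynomial (Fin n) k}
    (h : ∀ t, coeff 0 (f t) = 0) :
    f ∈ idealOfVars (Fin n) k • (⊤ : Submodule (MvPolynomial (Fin n) k)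
      (ι → MvPolynomial (Fin n) k)) := by
  classical
  rw [pi_eq_sum_univ f]
  exact Submodule.sum_mem _ fun t _ => Submodule.smul_mem_smul
    (mem_idealOfVars_of_coeff_zero (h t)) trivial

/-- A submodule generated by multihomogeneous elements has a finite generating family of such
elements whose syzygies have no nonzero constant coefficients. -/
theorem exists_minimal_generators [Fintype ι] (s : ι → Fin n →₀ ℕ)
    (P : Finset (Fin n) → Prop) (T : Set (ι → MvPolynomial (Fin n) k))
    (hT : ∀ f ∈ T, ∃ τ, P τ ∧ IsMultihomogeneous s (squarefreeExp τ) f) :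
    ∃ (r : ℕ) (τ : Fin r → Finset (Fin n))
      (φ : (Fin r → MvPolynomial (Fin n) k) →ₗ[MvPolynomial (Fin n) k]
        (ι → MvPolynomial (Fin n) k)),
      (∀ t, P (τ t)) ∧
      IsMultigraded (fun t => squarefreeExp (τ t)) s φ ∧
      LinearMap.range φ = Submodule.span (MvPolynomial (Fin n) k) T ∧
      LinearMap.ker φ ≤ idealOfVars (Fin n) k • (⊤ : Submodule (MvPolynomial (Fin n) k)
        (Fin r → MvPolynomial (Fin n) k)) := by
  classical
  -- The generators are a subset of `T` of least cardinality, so they inherit the property `P` of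
  -- their multidegrees.
  have hex : ∃ m, ∃ G : Finset (ι → MvPolynomial (Fin n) k), (G : Set _) ⊆ T ∧
      Submodule.span (MvPolynomial (Fin n) k) T = Submodule.span _ G ∧ G.card = m := by
    obtain ⟨G, h1, h2⟩ := (Submodule.fg_span_iff_fg_span_finset_subset T).1
      (IsNoetherian.noetherian (Submodule.span (MvPolynomial (Fin n) k) T))
    exact ⟨_, G, h1, h2, rfl⟩
  obtain ⟨G, hGT, hspan, hcard⟩ := Nat.find_spec hex
  have hmin : ∀ G' : Finset (ι → MvPolynomial (Fin n) k), (G' : Set _) ⊆ T →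
      Submodule.span (MvPolynomial (Fin n) k) T = Submodule.span _ G' → G.card ≤ G'.card := by
    intro G' h1 h2
    rw [hcard]
    exact Nat.find_min' hex ⟨G', h1, h2, rfl⟩
  let g : Fin G.card → ι → MvPolynomial (Fin n) k := fun t => (G.equivFin.symm t).1
  have hgG : ∀ t, g t ∈ G := fun t => (G.equivFin.symm t).2
  have hginj : Function.Injective g := Subtype.val_injective.comp G.equivFin.symm.injective
  have hgrange : Set.range g = G := by
    ext f
    refine ⟨?_, fun h => ⟨G.equivFin ⟨f, h⟩, by simp [g]⟩⟩
    rintro ⟨t, rfl⟩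
    exact hgG t
  choose τ hP hτ using fun t => hT (g t) (hGT (hgG t))
  let φ := Fintype.linearCombination (MvPolynomial (Fin n) k) g
  have hφ1 : ∀ t, φ (Pi.single t 1) = g t := by
    intro t
    simp only [φ, Fintype.linearCombination_apply_single, one_smul]
  have hgr : IsMultigraded (fun t => squarefreeExp (τ t)) s φ := by
    intro t
    rw [hφ1]
    exact hτ t
  refine ⟨G.card, τ, φ, hP, hgr, ?_, ?_⟩
  · rw [hspan, ← hgrange]
    exact Fintype.range_linearCombination _ g
  · intro f hf
    refine mem_idealOfVars_smul_top fun t => ?_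
    by_contra hc
    -- In the multidegree of the `t`-th generator, the `t`-th entry of the syzygy is a constant. If
    -- nonzero it is a unit, and `g t` lies in the span of the other generators, against minimality.
    set e := multiComponent (fun t => squarefreeExp (τ t)) (squarefreeExp (τ t)) f with he
    have hker : φ e = 0 := by
      rw [he, hgr.map_multiComponent, LinearMap.mem_ker.1 hf]
      funext u
      simp [multiComponent]
    have het : e t = C (coeff 0 (f t)) := by
      rw [he]
      simp only [multiComponent, le_refl, if_true, tsub_self]
      rfl
    have hsum : φ e = ∑ u, e u • g u := Fintype.linearCombination_apply _ _ _
    have hmem : g t ∈ Submodule.span (MvPolynomial (Fin n) k)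
        ((G.erase (g t) : Finset _) : Set (ι → MvPolynomial (Fin n) k)) := by
      rw [hsum, ← Finset.add_sum_erase _ _ (Finset.mem_univ t), het] at hker
      have hgt : g t = (C (coeff 0 (f t))⁻¹ : MvPolynomial (Fin n) k) •
          (C (coeff 0 (f t)) : MvPolynomial (Fin n) k) • g t := by
        rw [smul_smul, ← C_mul, inv_mul_cancel₀ hc, C_1, one_smul]
      rw [eq_neg_of_add_eq_zero_left hker] at hgt
      refine SetLike.mem_coe.1 (Set.mem_of_eq_of_mem hgt (SetLike.mem_coe.2 ?_))
      refine Submodule.smul_mem _ _ (Submodule.neg_mem _ (Submodule.sum_mem _ fun u hu =>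
        Submodule.smul_mem _ _ (Submodule.subset_span ?_)))
      exact Finset.mem_coe.2 (Finset.mem_erase.2
        ⟨fun h => (Finset.mem_erase.1 hu).1 (hginj h), hgG u⟩)
    have hle := hmin (G.erase (g t)) (fun f hf => hGT (Finset.mem_of_mem_erase hf)) (by
      rw [hspan]
      refine le_antisymm (Submodule.span_le.2 fun f hf => ?_)
        (Submodule.span_mono (Finset.coe_subset.2 (Finset.erase_subset _ _)))
      by_cases h : f = g t
      · rw [h]
        exact hmem
      · exact Submodule.subset_span (Finset.mem_coe.2 (Finset.mem_erase.2 ⟨h, hf⟩)))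
    exact absurd hle (not_le.2 (Finset.card_erase_lt_of_mem (hgG t)))

end Multigraded

/-! ### Construction of the minimal resolution and the regularity bound -/

section Resolution

/-- A multigraded map of free modules of finite rank with squarefree shifts whose syzygies have no
nonzero constant coefficients. -/
structure SquarefreeMap (k : Type*) [Field k] (n : ℕ) where
  source : ℕ
  target : ℕ
  sourceDeg : Fin source → Finset (Fin n)
  targetDeg : Fin target → Finset (Fin n)
  map : (Fin source → MvPolynomial (Fin n) k) →ₗ[MvPolynomial (Fin n) k]
    (Fin target → MvPolynomial (Fin n) k)
  multigraded : IsMultigraded (fun t => squarefreeExp (sourceDeg t))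
    (fun t => squarefreeExp (targetDeg t)) map
  minimal : LinearMap.ker map ≤ idealOfVars (Fin n) k • (⊤ : Submodule (MvPolynomial (Fin n) k)
    (Fin source → MvPolynomial (Fin n) k))

variable {k : Type*} [Field k] {n : ℕ}

theorem SquarefreeMap.exists_next (A : SquarefreeMap k n) :
    ∃ B : (r : ℕ) × (Fin r → Finset (Fin n)) ×
      ((Fin r → MvPolynomial (Fin n) k) →ₗ[MvPolynomial (Fin n) k]
        (Fin A.source → MvPolynomial (Fin n) k)),
      IsMultigraded (fun t => squarefreeExp (B.2.1 t)) (fun t => squarefreeExp (A.sourceDeg t))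
        B.2.2 ∧
      LinearMap.range B.2.2 = LinearMap.ker A.map ∧
      LinearMap.ker B.2.2 ≤ idealOfVars (Fin n) k • (⊤ : Submodule (MvPolynomial (Fin n) k)
        (Fin B.1 → MvPolynomial (Fin n) k)) := by
  obtain ⟨r, τ, φ, -, h1, h2, h3⟩ := exists_minimal_generators
    (fun t => squarefreeExp (A.sourceDeg t)) (fun _ => True)
    {f | A.map f = 0 ∧ ∃ τ, IsMultihomogeneous (fun t => squarefreeExp (A.sourceDeg t))
      (squarefreeExp τ) f} (fun f hf => ⟨hf.2.choose, trivial, hf.2.choose_spec⟩)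
  exact ⟨⟨r, τ, φ⟩, h1, h2.trans A.multigraded.ker_eq_span.symm, h3⟩

/-- A map onto the kernel of `A`, given by a minimal set of generators. -/
def SquarefreeMap.next (A : SquarefreeMap k n) : SquarefreeMap k n where
  source := A.exists_next.choose.1
  target := A.source
  sourceDeg := A.exists_next.choose.2.1
  targetDeg := A.sourceDeg
  map := A.exists_next.choose.2.2
  multigraded := A.exists_next.choose_spec.1
  minimal := A.exists_next.choose_spec.2.2

theorem SquarefreeMap.range_next (A : SquarefreeMap k n) :
    LinearMap.range A.next.map = LinearMap.ker A.map :=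
  A.exists_next.choose_spec.2.1

theorem SquarefreeMap.exact_next (A : SquarefreeMap k n) : Function.Exact A.next.map A.map :=
  fun y => (SetLike.ext_iff.1 A.range_next y).symm

/-- The maps of the minimal resolution that begins with `A`. -/
def SquarefreeMap.iterate (A : SquarefreeMap k n) : ℕ → SquarefreeMap k n
  | 0 => A
  | i + 1 => (A.iterate i).next

variable {M : Type*} [AddCommGroup M] [Module k M] [Module (MvPolynomial (Fin n) k) M]
  [IsScalarTower k (MvPolynomial (Fin n) k) M]

/-- The minimal graded free resolution of the cokernel of `A`, with degrees shifted by `c`. -/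
def SquarefreeMap.resolution (A : SquarefreeMap k n) (grading : ℤ → Submodule k M) (c : ℤ)
    (aug : (Fin A.target → MvPolynomial (Fin n) k) →ₗ[MvPolynomial (Fin n) k] M)
    (aug_homogeneous : ∀ j : ℤ, ∀ f ∈ gradedFree (k := k)
      (fun t => ((A.targetDeg t).card : ℤ) - c) j, aug f ∈ grading j)
    (aug_surjective : Function.Surjective aug)
    (exact : LinearMap.range A.map = LinearMap.ker aug)
    (minimal : LinearMap.range A.map ≤ idealOfVars (Fin n) k •
      (⊤ : Submodule (MvPolynomial (Fin n) k) (Fin A.target → MvPolynomial (Fin n) k))) :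
    MinimalGradedFreeResolution n grading where
  rank i := (A.iterate i).target
  deg i t := (((A.iterate i).targetDeg t).card : ℤ) - c
  d i := (A.iterate i).map
  aug := aug
  d_homogeneous i j _ hf := (A.iterate i).multigraded.map_mem_gradedFree c j hf
  aug_homogeneous := aug_homogeneous
  aug_surjective := aug_surjective
  exact_zero := fun y => (SetLike.ext_iff.1 exact y).symm
  exact_succ i := (A.iterate i).exact_next
  minimal i := by
    cases i with
    | zero => exact minimal
    | succ i => exact (A.iterate i).range_next.trans_le (A.iterate i).minimal

/-- If the generators have degree at most `n - 2` and the relations have degree at most `n - 1`,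
then the regularity is at most `n - 2`, as all further shifts are squarefree. -/
theorem SquarefreeMap.regularity_le (A : SquarefreeMap k n) (grading : ℤ → Submodule k M) (c : ℤ)
    (aug : (Fin A.target → MvPolynomial (Fin n) k) →ₗ[MvPolynomial (Fin n) k] M)
    (aug_homogeneous : ∀ j : ℤ, ∀ f ∈ gradedFree (k := k)
      (fun t => ((A.targetDeg t).card : ℤ) - c) j, aug f ∈ grading j)
    (aug_surjective : Function.Surjective aug)
    (exact : LinearMap.range A.map = LinearMap.ker aug)
    (minimal : LinearMap.range A.map ≤ idealOfVars (Fin n) k •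
      (⊤ : Submodule (MvPolynomial (Fin n) k) (Fin A.target → MvPolynomial (Fin n) k)))
    (htarget : ∀ t, (A.targetDeg t).card + 2 ≤ n) (hsource : ∀ t, (A.sourceDeg t).card + 1 ≤ n) :
    regularity n grading ≤ (((n : ℤ) - 2 - c : ℤ) : ℝ) := by
  -- As `regularity` is an infimum, bounding one minimal resolution suffices.
  refine (iInf_le _ (A.resolution grading c aug aug_homogeneous aug_surjective exact
    minimal)).trans (iSup₂_le fun i t => ?_)
  rw [EReal.coe_le_coe_iff, Int.cast_le]
  change (((A.iterate i).targetDeg t).card : ℤ) - c - i ≤ _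
  match i, t with
  | 0, t =>
    have := htarget t
    change ((A.targetDeg t).card : ℤ) - c - (0 : ℕ) ≤ _
    omega
  | 1, t =>
    have := hsource t
    change ((A.sourceDeg t).card : ℤ) - c - (1 : ℕ) ≤ _
    omega
  | i + 2, t =>
    -- A squarefree shift is at most `n`, and the homological index is at least `2`.
    have := card_finset_fin_le ((A.iterate (i + 2)).targetDeg t)
    omega

end Resolution

/-! ### The Koszul complex of the full simplex and its exactness -/

section FullKoszul

variable {k : Type*} [Field k] {n : ℕ}

/-- The total Koszul differential on the free module spanned by all exterior monomials. -/
def fullD (k : Type*) [Field k] (n : ℕ) :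
    (Finset (Fin n) → MvPolynomial (Fin n) k) →ₗ[MvPolynomial (Fin n) k]
      (Finset (Fin n) → MvPolynomial (Fin n) k) where
  -- The sign of `v` in `insert v τ` can be read off `τ`, since `v` is not smaller than itself.
  toFun f τ := ∑ v ∈ τᶜ, (-1) ^ (τ.filter (· < v)).card * X v * f (insert v τ)
  map_add' f g := by
    funext τ
    simp [mul_add, Finset.sum_add_distrib]
  map_smul' c f := by
    funext τ
    simp only [Pi.smul_apply, smul_eq_mul, RingHom.id_apply, Finset.mul_sum]
    exact Finset.sum_congr rfl fun v _ => by ring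

theorem fullD_apply (f : Finset (Fin n) → MvPolynomial (Fin n) k) (τ : Finset (Fin n)) :
    fullD k n f τ = ∑ v ∈ τᶜ, (-1) ^ (τ.filter (· < v)).card * X v * f (insert v τ) :=
  rfl

/-- Left multiplication by `v` on the free module spanned by all exterior monomials. -/
def wedge (k : Type*) [Field k] {n : ℕ} (v : Fin n) :
    (Finset (Fin n) → MvPolynomial (Fin n) k) →ₗ[MvPolynomial (Fin n) k]
      (Finset (Fin n) → MvPolynomial (Fin n) k) where
  toFun f σ := if v ∈ σ then (-1) ^ (σ.filter (· < v)).card * f (σ.erase v) else 0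
  map_add' f g := by
    funext σ
    by_cases h : v ∈ σ <;> simp [h, mul_add]
  map_smul' c f := by
    funext σ
    by_cases h : v ∈ σ <;> simp [h, mul_left_comm]

theorem wedge_apply (v : Fin n) (f : Finset (Fin n) → MvPolynomial (Fin n) k)
    (σ : Finset (Fin n)) : wedge k v f σ =
      if v ∈ σ then (-1) ^ (σ.filter (· < v)).card * f (σ.erase v) else 0 :=
  rfl

theorem filter_lt_erase_self (σ : Finset (Fin n)) (v : Fin n) :
    (σ.erase v).filter (· < v) = σ.filter (· < v) := by
  ext a
  simp only [Finset.mem_filter, Finset.mem_erase]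
  grind

theorem filter_lt_insert_self (σ : Finset (Fin n)) (v : Fin n) :
    (insert v σ).filter (· < v) = σ.filter (· < v) := by
  ext a
  simp only [Finset.mem_filter, Finset.mem_insert]
  grind

/-- Wedging with `v` and contracting `w ≠ v` anticommute; this is the sign behind the cancellation
in `fullD_wedge`. -/
theorem neg_one_pow_koszul_sign {τ : Finset (Fin n)} {v w : Fin n} (hv : v ∈ τ) (hw : w ∉ τ) :
    ((-1) ^ ((τ.filter (· < w)).card + ((insert w τ).filter (· < v)).card) :
      MvPolynomial (Fin n) k) =
      - (-1) ^ ((τ.filter (· < v)).card + ((τ.erase v).filter (· < w)).card) := by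
  have hne : v ≠ w := fun h => hw (h ▸ hv)
  have e1 : (insert w τ).erase w = τ := Finset.erase_insert hw
  have e2 : (insert w τ).erase v = insert w (τ.erase v) := by
    rw [Finset.erase_insert_of_ne hne.symm]
  have e3 : ((insert w τ).filter (· < w)).card = (τ.filter (· < w)).card := by
    rw [filter_lt_insert_self]
  have e4 : ((insert w (τ.erase v)).filter (· < w)).card = ((τ.erase v).filter (· < w)).card := by
    rw [filter_lt_insert_self]
  have key : Odd ((τ.filter (· < w)).card + ((insert w τ).filter (· < v)).card +
      ((τ.filter (· < v)).card + ((τ.erase v).filter (· < w)).card)) := by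
    rcases lt_or_gt_of_ne hne with h | h
    · have := koszul_sign (insert w τ) (Finset.mem_insert_of_mem hv) h
      rw [e1, e2, e3, e4] at this
      exact ⟨((insert w τ).filter (· < v)).card + ((τ.erase v).filter (· < w)).card, by omega⟩
    · have := koszul_sign (insert w τ) (Finset.mem_insert_self w τ) h
      rw [e1, e2, e3, e4] at this
      exact ⟨(τ.filter (· < w)).card + (τ.filter (· < v)).card, by omega⟩
  have h := key.neg_one_pow (α := MvPolynomial (Fin n) k)
  rw [pow_add] at h
  rcases neg_one_pow_eq_or (MvPolynomial (Fin n) k)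
    ((τ.filter (· < v)).card + ((τ.erase v).filter (· < w)).card) with h' | h' <;>
  · rw [h'] at h ⊢
    first | linear_combination h | linear_combination -h

/-- The Leibniz rule for `∂` with `∂ v = x_v`: wedging with `v` is a homotopy between multiplication
by `x_v` and zero. -/
theorem fullD_wedge (v : Fin n) (f : Finset (Fin n) → MvPolynomial (Fin n) k) :
    fullD k n (wedge k v f) + wedge k v (fullD k n f) = (X v : MvPolynomial (Fin n) k) • f := by
  funext τ
  have sq : ∀ m : ℕ, ((-1) ^ m * (-1) ^ m : MvPolynomial (Fin n) k) = 1 := fun m => by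
    rw [← mul_pow]
    simp
  simp only [Pi.add_apply, fullD_apply, wedge_apply, Pi.smul_apply, smul_eq_mul]
  by_cases hv : v ∈ τ
  · have e : (τ.erase v)ᶜ = insert v τᶜ := by
      ext a
      simp only [Finset.mem_compl, Finset.mem_erase, Finset.mem_insert]
      tauto
    rw [if_pos hv, e, Finset.sum_insert (by simpa using hv), Finset.insert_erase hv,
      filter_lt_erase_self, mul_add, ← mul_assoc, ← mul_assoc, sq, one_mul, add_left_comm,
      Finset.mul_sum, ← Finset.sum_add_distrib, Finset.sum_eq_zero, add_zero]
    intro w hw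
    have hw : w ∉ τ := Finset.mem_compl.1 hw
    have hne : w ≠ v := fun h => hw (h ▸ hv)
    have key := neg_one_pow_koszul_sign (k := k) hv hw
    rw [if_pos (Finset.mem_insert_of_mem hv), Finset.erase_insert_of_ne hne]
    rw [pow_add, pow_add] at key
    linear_combination (X w * f (insert w (τ.erase v))) * key
  · rw [if_neg hv, add_zero, Finset.sum_eq_single v]
    · rw [if_pos (Finset.mem_insert_self v τ), Finset.erase_insert hv, filter_lt_insert_self]
      linear_combination (X v * f τ) * sq (τ.filter (· < v)).card
    · intro w _ hwv
      rw [if_neg, mul_zero]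
      simp [hv, hwv.symm]
    · simp [hv]

theorem wedge_single {σ : Finset (Fin n)} {v : Fin n} (hv : v ∉ σ) :
    wedge k v (Pi.single σ 1) = ((-1) ^ (σ.filter (· < v)).card : MvPolynomial (Fin n) k) •
      Pi.single (insert v σ) 1 := by
  funext τ
  simp only [wedge_apply, Pi.smul_apply, smul_eq_mul]
  by_cases h : τ = insert v σ
  · subst h
    simp [Finset.erase_insert hv, filter_lt_insert_self]
  · rw [Pi.single_eq_of_ne h, mul_zero]
    split_ifs with hvτ
    · rw [Pi.single_eq_of_ne, mul_zero]
      rintro rfl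
      exact h (Finset.insert_erase hvτ).symm
    · rfl

/-- Induction on the simplex: applying the homotopy formula to `g` and to `∂ g` gives `∂∂(v ∧ g) = v
∧ ∂∂g`. -/
theorem fullD_fullD (f : Finset (Fin n) → MvPolynomial (Fin n) k) :
    fullD k n (fullD k n f) = 0 := by
  suffices h : fullD k n ∘ₗ fullD k n = 0 from LinearMap.congr_fun h f
  refine LinearMap.pi_ext' fun σ => LinearMap.ext_ring ?_
  simp only [LinearMap.comp_apply, LinearMap.coe_single, LinearMap.zero_apply]
  induction σ using Finset.induction_on with
  | empty =>
    have : fullD k n (Pi.single ∅ 1) = 0 := by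
      funext τ
      rw [fullD_apply]
      refine Finset.sum_eq_zero fun v _ => ?_
      rw [Pi.single_eq_of_ne (Finset.insert_ne_empty v τ), mul_zero]
    rw [this, map_zero]
  | insert v σ hv ih =>
    set g : Finset (Fin n) → MvPolynomial (Fin n) k := Pi.single σ 1
    have h1 := congrArg (fullD k n) (fullD_wedge v g)
    have h2 := fullD_wedge v (fullD k n g)
    rw [map_add, map_smul] at h1
    rw [ih, map_zero, add_zero] at h2
    rw [h2, add_eq_right, wedge_single hv, map_smul, map_smul] at h1
    exact (smul_eq_zero.1 h1).resolve_left (pow_ne_zero _ (neg_ne_zero.2 one_ne_zero))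

theorem isMultigraded_fullD : IsMultigraded squarefreeExp squarefreeExp (fullD k n) := by
  classical
  intro σ τ m hm
  rw [fullD_apply] at hm
  obtain ⟨v, hv, h⟩ := Finset.mem_biUnion.1 (support_sum hm)
  have hv : v ∉ τ := Finset.mem_compl.1 hv
  by_cases hσ : insert v τ = σ
  · subst hσ
    have e : ((-1) ^ (τ.filter (· < v)).card * X v *
        (Pi.single (insert v τ) 1 : Finset (Fin n) → MvPolynomial (Fin n) k) (insert v τ)) =
        monomial (Finsupp.single v 1) ((-1) ^ (τ.filter (· < v)).card : k) := by
      rw [Pi.single_eq_same, mul_one, X,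
        show ((-1) ^ (τ.filter (· < v)).card : MvPolynomial (Fin n) k) =
          C ((-1) ^ (τ.filter (· < v)).card) by simp, C_mul_monomial, mul_one]
    rw [e] at h
    rw [Finset.mem_singleton.1 (support_monomial_subset h), squarefreeExp_insert hv]
  · rw [Pi.single_eq_of_ne hσ, mul_zero] at h
    simp at h

/-- The chains that are supported in homological degree `j`. -/
def cardSupported (k : Type*) [Field k] (n j : ℕ) :
    Submodule (MvPolynomial (Fin n) k) (Finset (Fin n) → MvPolynomial (Fin n) k) where
  carrier := {f | ∀ σ, σ.card ≠ j → f σ = 0}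
  zero_mem' _ _ := rfl
  add_mem' hf hg σ h := by rw [Pi.add_apply, hf σ h, hg σ h, add_zero]
  smul_mem' c f hf σ h := by rw [Pi.smul_apply, hf σ h, smul_zero]

theorem fullD_mem_cardSupported {j : ℕ} {f : Finset (Fin n) → MvPolynomial (Fin n) k}
    (hf : f ∈ cardSupported k n (j + 1)) : fullD k n f ∈ cardSupported k n j := by
  intro τ h
  rw [fullD_apply]
  refine Finset.sum_eq_zero fun v hv => ?_
  rw [hf, mul_zero]
  rwa [Finset.card_insert_of_notMem (Finset.mem_compl.1 hv), Ne, Nat.add_right_cancel_iff]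

theorem single_mem_cardSupported (σ : Finset (Fin n)) :
    (Pi.single σ 1 : Finset (Fin n) → MvPolynomial (Fin n) k) ∈ cardSupported k n σ.card :=
  fun _ h => Pi.single_eq_of_ne (by rintro rfl; exact h rfl) _

/-- Needed for minimality of the presentation: relations have entries in `(x₁, …, xₙ)`. -/
theorem coeff_zero_fullD (f : Finset (Fin n) → MvPolynomial (Fin n) k) (τ : Finset (Fin n)) :
    coeff 0 (fullD k n f τ) = 0 := by
  rw [fullD_apply, coeff_sum]
  refine Finset.sum_eq_zero fun v _ => ?_
  rw [← constantCoeff_eq]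
  simp

/-- The full Koszul complex is exact in positive homological degrees. -/
theorem exists_fullD_eq {i : ℕ} {z : Finset (Fin n) → MvPolynomial (Fin n) k}
    (hz : fullD k n z = 0) (hsupp : z ∈ cardSupported k n (i + 1)) :
    ∃ g ∈ cardSupported k n (i + 2), fullD k n g = z := by
  rw [← Submodule.mem_map]
  refine mem_of_multiComponent_mem squarefreeExp fun a => ?_
  set y := multiComponent squarefreeExp a z with hy
  have hya : IsMultihomogeneous squarefreeExp a y := isMultihomogeneous_multiComponent _ _ _
  have hysupp : y ∈ cardSupported k n (i + 1) := by
    intro σ h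
    ext m
    rw [hy, coeff_multiComponent, hsupp σ h]
    simp
  have hDy : fullD k n y = 0 := by
    rw [hy, isMultigraded_fullD.map_multiComponent, hz]
    funext u
    simp [multiComponent]
  by_cases hy0 : y = 0
  · rw [hy0]
    exact Submodule.zero_mem _
  obtain ⟨σ, hσ⟩ := Function.ne_iff.1 hy0
  obtain ⟨m, hm⟩ := support_nonempty.2 hσ
  have hσcard : σ.card = i + 1 := by
    by_contra h
    exact hσ (hysupp σ h)
  obtain ⟨v, hv⟩ : σ.Nonempty := Finset.card_pos.1 (by omega)
  have hav : a v ≠ 0 := by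
    rw [← hya σ m hm]
    simp [squarefreeExp_apply, hv]
  -- Entries of `v ∧ y` come from sets avoiding `v`, so all of `a v > 0` is carried by their
  -- coefficients. Since `∂(v ∧ y) = x_v y`, dividing by `x_v` gives a preimage of `y`.
  have hdvd : ∀ τ, ∃ c, wedge k v y τ = X v * c := by
    intro τ
    rw [wedge_apply]
    split_ifs with h
    · refine dvd_mul_of_dvd_right ?_ _
      rw [← Ideal.mem_span_singleton, ← Set.image_singleton, mem_ideal_span_X_image]
      intro m' hm'
      refine ⟨v, rfl, ?_⟩
      have := hya _ m' hm'
      rw [← this] at hav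
      simpa [squarefreeExp_apply] using hav
    · exact ⟨0, by simp⟩
  choose w hw using hdvd
  have hw' : wedge k v y = (X v : MvPolynomial (Fin n) k) • w := funext hw
  have hX : (X v : MvPolynomial (Fin n) k) ≠ 0 := X_ne_zero v
  have hwy : fullD k n w = y := by
    have h := fullD_wedge v y
    rw [hDy, map_zero, add_zero, hw', map_smul] at h
    exact smul_right_injective _ hX h
  refine ⟨w, fun τ h => ?_, hwy⟩
  have h1 := hw τ
  rw [wedge_apply] at h1
  refine (mul_eq_zero.1 (h1.symm.trans ?_)).resolve_left hX
  split_ifs with hvτ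
  · rw [hysupp, mul_zero]
    have := Finset.card_erase_add_one hvτ
    omega
  · rfl

end FullKoszul

/-! ### Comparison of `Δ` with the full simplex and the presentation of its Koszul module -/

section Comparison

variable {k : Type*} [Field k] {n : ℕ}

theorem fullD_single (σ : Finset (Fin n)) :
    fullD k n (Pi.single σ 1) = ∑ v ∈ σ,
      ((-1) ^ (σ.filter (· < v)).card * X v : MvPolynomial (Fin n) k) •
        (Pi.single (σ.erase v) 1 : Finset (Fin n) → MvPolynomial (Fin n) k) := by
  funext τ
  rw [fullD_apply, Finset.sum_apply, ← Finset.sum_filter_add_sum_filter_not τᶜ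
    (fun v => insert v τ = σ), ← Finset.sum_filter_add_sum_filter_not σ (fun v => σ.erase v = τ),
    Finset.sum_eq_zero (s := τᶜ.filter fun v => ¬ insert v τ = σ),
    Finset.sum_eq_zero (s := σ.filter fun v => ¬ σ.erase v = τ), add_zero, add_zero]
  · refine Finset.sum_congr ?_ ?_
    · ext v
      simp only [Finset.mem_filter, Finset.mem_compl]
      constructor
      · rintro ⟨h, rfl⟩
        exact ⟨Finset.mem_insert_self _ _, Finset.erase_insert h⟩
      · rintro ⟨h, rfl⟩
        exact ⟨Finset.notMem_erase _ _, Finset.insert_erase h⟩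
    · intro v hv
      rw [Finset.mem_filter] at hv
      obtain ⟨hv, rfl⟩ := hv
      simp [filter_lt_erase_self, Finset.insert_erase hv]
  · intro v hv
    rw [Pi.smul_apply, Pi.single_eq_of_ne (Ne.symm (Finset.mem_filter.1 hv).2), smul_zero]
  · intro v hv
    rw [Pi.single_eq_of_ne (Finset.mem_filter.1 hv).2, mul_zero]

variable (k) in
open Classical in
/-- Extension by zero of the Koszul chains of `Δ` to chains of the full simplex. -/
def extend (Δ : AbstractSimplicialComplex (Fin n)) (i : ℕ) :
    KoszulChain k Δ i →ₗ[MvPolynomial (Fin n) k] (Finset (Fin n) → MvPolynomial (Fin n) k) where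
  toFun f σ := if h : (σ = ∅ ∨ σ ∈ Δ) ∧ σ.card = i then f ⟨σ, h⟩ else 0
  map_add' f g := by
    funext σ
    by_cases h : (σ = ∅ ∨ σ ∈ Δ) ∧ σ.card = i <;> simp [h]
  map_smul' c f := by
    funext σ
    by_cases h : (σ = ∅ ∨ σ ∈ Δ) ∧ σ.card = i <;> simp [h]

variable (k) in
/-- Restriction of chains of the full simplex to Koszul chains of `Δ`. -/
def restrict (Δ : AbstractSimplicialComplex (Fin n)) (i : ℕ) :
    (Finset (Fin n) → MvPolynomial (Fin n) k) →ₗ[MvPolynomial (Fin n) k] KoszulChain k Δ i :=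
  LinearMap.funLeft (MvPolynomial (Fin n) k) (MvPolynomial (Fin n) k) Subtype.val

variable {Δ : AbstractSimplicialComplex (Fin n)} {i : ℕ}

theorem extend_apply (f : KoszulChain k Δ i) (σ : Simplex Δ i) : extend k Δ i f σ.1 = f σ := by
  have h : extend k Δ i f σ.1 = f ⟨σ.1, σ.2⟩ := dif_pos σ.2
  exact h

theorem extend_apply_of_not (f : KoszulChain k Δ i) {σ : Finset (Fin n)}
    (h : ¬ ((σ = ∅ ∨ σ ∈ Δ) ∧ σ.card = i)) : extend k Δ i f σ = 0 :=
  dif_neg h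

theorem restrict_extend (f : KoszulChain k Δ i) : restrict k Δ i (extend k Δ i f) = f :=
  funext fun σ => extend_apply f σ

theorem extend_mem_cardSupported (f : KoszulChain k Δ i) :
    extend k Δ i f ∈ cardSupported k n i :=
  fun _ h => extend_apply_of_not f fun h' => h h'.2

theorem extend_single (σ : Simplex Δ i) : extend k Δ i (Pi.single σ 1) = Pi.single σ.1 1 := by
  funext τ
  by_cases h : (τ = ∅ ∨ τ ∈ Δ) ∧ τ.card = i
  · rw [show τ = (⟨τ, h⟩ : Simplex Δ i).1 from rfl, extend_apply]
    simp only [Pi.single_apply, Subtype.ext_iff]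
  · rw [extend_apply_of_not _ h, Pi.single_eq_of_ne]
    rintro rfl
    exact h σ.2

/-- Faces of simplices are simplices, so extension by zero is a chain map. -/
theorem fullD_extend (f : KoszulChain k Δ (i + 1)) :
    fullD k n (extend k Δ (i + 1) f) = extend k Δ i (koszulD k Δ i f) := by
  suffices h : fullD k n ∘ₗ extend k Δ (i + 1) = extend k Δ i ∘ₗ koszulD k Δ i from
    LinearMap.congr_fun h f
  refine LinearMap.pi_ext' fun σ => LinearMap.ext_ring ?_
  simp only [LinearMap.comp_apply, LinearMap.coe_single, koszulD_single, map_sum, map_smul,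
    extend_single, fullD_single]
  exact (Finset.sum_coe_sort σ.1 fun v =>
    ((-1) ^ (σ.1.filter (· < v)).card * X v : MvPolynomial (Fin n) k) •
      (Pi.single (σ.1.erase v) 1 : Finset (Fin n) → MvPolynomial (Fin n) k)).symm

theorem extend_restrict (hΔ : ∀ σ : Finset (Fin n), σ.card = i → σ = ∅ ∨ σ ∈ Δ)
    {f : Finset (Fin n) → MvPolynomial (Fin n) k} (hf : f ∈ cardSupported k n i) :
    extend k Δ i (restrict k Δ i f) = f := by
  funext σ
  by_cases h : σ.card = i
  · exact extend_apply _ (⟨σ, hΔ σ h, h⟩ : Simplex Δ i)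
  · rw [extend_apply_of_not _ fun h' => h h'.2, hf σ h]

/-- If all sets of `i + 1` vertices are simplices, then `W_{i+1}(Δ)` is generated in degree `i + 2`
with relations in degree `i + 3`. -/
theorem regularity_koszulModule_le (hΔ : ∀ σ : Finset (Fin n), σ.card = i + 1 → σ = ∅ ∨ σ ∈ Δ)
    (hn : i + 4 ≤ n) (c : ℤ) :
    regularity n (shift (koszulGrading k Δ (i + 1)) c) ≤ (((n : ℤ) - 2 - c : ℤ) : ℝ) := by
  classical
  -- `s` enumerates the missing faces with `i + 2` vertices, which index the generators.
  obtain ⟨r, s, hinj, hs⟩ : ∃ (r : ℕ) (s : Fin r → Finset (Fin n)), Function.Injective s ∧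
      ∀ ρ, (ρ ∉ Δ ∧ ρ.card = i + 2) ↔ ∃ t, s t = ρ := by
    let e := Fintype.equivFin {ρ : Finset (Fin n) // ρ ∉ Δ ∧ ρ.card = i + 2}
    refine ⟨_, fun t => (e.symm t).1, Subtype.val_injective.comp e.symm.injective, fun ρ =>
      ⟨fun h => ⟨e ⟨ρ, h⟩, by simp⟩, ?_⟩⟩
    rintro ⟨t, rfl⟩
    exact (e.symm t).2
  have hsΔ : ∀ t, s t ∉ Δ := fun t => ((hs _).2 ⟨t, rfl⟩).1
  have hscard : ∀ t, (s t).card = i + 2 := fun t => ((hs _).2 ⟨t, rfl⟩).2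
  let ext' := Fintype.linearCombination (MvPolynomial (Fin n) k)
    fun t => (Pi.single (s t) 1 : Finset (Fin n) → MvPolynomial (Fin n) k)
  let res' := LinearMap.funLeft (MvPolynomial (Fin n) k) (MvPolynomial (Fin n) k) s
  have hext1 : ∀ t, ext' (Pi.single t 1) = Pi.single (s t) 1 := by
    intro t
    simp only [ext', Fintype.linearCombination_apply_single, one_smul]
  have hextapply : ∀ f t, ext' f (s t) = f t := by
    intro f t
    simp only [ext', Fintype.linearCombination_apply, Finset.sum_apply, Pi.smul_apply,
      Pi.single_apply, hinj.eq_iff, smul_eq_mul, mul_ite, mul_one, mul_zero, Finset.sum_ite_eq,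
      Finset.mem_univ, if_true]
  have hext0 : ∀ f σ, (∀ t, s t ≠ σ) → ext' f σ = 0 := by
    intro f σ h
    simp only [ext', Fintype.linearCombination_apply, Finset.sum_apply, Pi.smul_apply]
    exact Finset.sum_eq_zero fun t _ => by rw [Pi.single_eq_of_ne (h t).symm, smul_zero]
  have hextsupp : ∀ f, ext' f ∈ cardSupported k n (i + 2) :=
    fun f σ h => hext0 f σ fun t e => h (e ▸ hscard t)
  have hresext : ∀ f, res' (ext' f) = f := fun f => funext fun t => hextapply f t
  have hresextend : ∀ y : KoszulChain k Δ (i + 2), res' (extend k Δ (i + 2) y) = 0 := by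
    intro y
    funext t
    refine extend_apply_of_not y fun h => h.1.elim (fun h0 => ?_) (hsΔ t)
    have := hscard t
    rw [h0] at this
    simp at this
  have hdecomp : ∀ g ∈ cardSupported k n (i + 2),
      g = ext' (res' g) + extend k Δ (i + 2) (restrict k Δ (i + 2) g) := by
    intro g hg
    funext σ
    rw [Pi.add_apply]
    by_cases hσ : σ.card = i + 2
    · by_cases hσΔ : σ ∈ Δ
      · rw [hext0 _ σ (fun t e => hsΔ t (e ▸ hσΔ)), zero_add]
        exact (extend_apply (restrict k Δ (i + 2) g)
          (⟨σ, Or.inr hσΔ, hσ⟩ : Simplex Δ (i + 2))).symm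
      · obtain ⟨t, rfl⟩ := (hs σ).1 ⟨hσΔ, hσ⟩
        have := congrFun (hresextend (restrict k Δ (i + 2) g)) t
        change extend k Δ (i + 2) (restrict k Δ (i + 2) g) (s t) = 0 at this
        rw [hextapply, this, add_zero]
        rfl
    · rw [hg σ hσ, hextsupp _ σ hσ, extend_mem_cardSupported _ σ hσ, add_zero]
  let φ := restrict k Δ (i + 1) ∘ₗ fullD k n ∘ₗ ext'
  have hφext : ∀ f, extend k Δ (i + 1) (φ f) = fullD k n (ext' f) :=
    fun f => extend_restrict hΔ (fullD_mem_cardSupported (hextsupp f))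
  have hφgr : IsMultigraded (fun t => squarefreeExp (s t))
      (fun σ : Simplex Δ (i + 1) => squarefreeExp σ.1) φ := by
    intro t σ
    have : φ (Pi.single t 1) = restrict k Δ (i + 1) (fullD k n (Pi.single (s t) 1)) := by
      rw [← hext1]
      rfl
    rw [this]
    exact isMultigraded_fullD (s t) σ.1
  have hinjext : ∀ j, Function.Injective (extend k Δ j) :=
    fun j => Function.LeftInverse.injective restrict_extend
  have hφcyc : ∀ f, φ f ∈ koszulCycles k Δ (i + 1) := by
    intro f
    refine LinearMap.mem_ker.2 (hinjext i ?_)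
    rw [← fullD_extend, hφext, fullD_fullD, map_zero]
  let aug := ((LinearMap.range (koszulD k Δ (i + 1))).submoduleOf
    (koszulCycles k Δ (i + 1))).mkQ ∘ₗ φ.codRestrict _ hφcyc
  have haug0 : ∀ f, aug f = 0 ↔ ∃ y, fullD k n (extend k Δ (i + 2) y) = fullD k n (ext' f) := by
    intro f
    refine (Submodule.Quotient.mk_eq_zero _).trans (Submodule.mem_comap.trans
      (LinearMap.mem_range.trans (exists_congr fun y => ?_)))
    rw [fullD_extend, ← hφext, (hinjext (i + 1)).eq_iff]
    rfl
  let T : Set (Fin r → MvPolynomial (Fin n) k) :=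
    {f | ∃ π : Finset (Fin n), π.card = i + 3 ∧ res' (fullD k n (Pi.single π 1)) = f}
  have hker : LinearMap.ker aug = Submodule.span (MvPolynomial (Fin n) k) T := by
    refine le_antisymm (fun f hf => ?_) (Submodule.span_le.2 ?_)
    · obtain ⟨y, hy⟩ := (haug0 f).1 hf
      -- `ext' f` and `y` have the same boundary, so their difference is some `∂ g`; since `y`
      -- vanishes on missing faces, `f` is the restriction of `∂ g` to them.
      obtain ⟨g, hg, hgz⟩ := exists_fullD_eq (i := i + 1) (z := ext' f - extend k Δ (i + 2) y)
        (by rw [map_sub, hy, sub_self])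
        (Submodule.sub_mem _ (hextsupp f) (extend_mem_cardSupported y))
      have hfg : f = (res' ∘ₗ fullD k n) g := by
        rw [LinearMap.comp_apply, hgz, map_sub, hresext, hresextend, sub_zero]
      rw [hfg, LinearMap.pi_apply_eq_sum_univ _ g]
      refine Submodule.sum_mem _ fun ρ _ => ?_
      by_cases h : ρ.card = i + 3
      · refine Submodule.smul_mem _ _ (Submodule.subset_span ⟨ρ, h, ?_⟩)
        rw [LinearMap.comp_apply]
        congr 2
        funext τ
        simp [Pi.single_apply, eq_comm]
      · rw [hg ρ h, zero_smul]
        exact Submodule.zero_mem _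
    · rintro _ ⟨π, hπ, rfl⟩
      -- Split `∂ v_π` into missing faces and faces: as `∂∂ v_π = 0`, the two parts have opposite
      -- boundaries.
      refine (haug0 _).2 ⟨-restrict k Δ (i + 2) (fullD k n (Pi.single π 1)), ?_⟩
      have h1 := hdecomp (fullD k n (Pi.single π 1))
        (fullD_mem_cardSupported (hπ ▸ single_mem_cardSupported π))
      have h2 := congrArg (fullD k n) h1
      rw [fullD_fullD, map_add] at h2
      rw [map_neg, map_neg]
      exact (eq_neg_of_add_eq_zero_left h2.symm).symm
  obtain ⟨r', τ, ψ, hτ, hψgr, hψrange, hψker⟩ := exists_minimal_generators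
    (fun t => squarefreeExp (s t)) (fun τ => τ.card = i + 3) T (by
      rintro _ ⟨π, hπ, rfl⟩
      exact ⟨π, hπ, fun t => isMultigraded_fullD π (s t)⟩)
  let A : SquarefreeMap k n := ⟨r', r, τ, s, ψ, hψgr, hψker⟩
  refine A.regularity_le _ c aug ?_ ?_ (hψrange.trans hker.symm) (hψrange.trans_le
    (Submodule.span_le.2 ?_)) ?_ ?_
  · intro j f hf
    refine ⟨⟨φ f, hφcyc f⟩, fun σ m hm => ?_, rfl⟩
    have h1 : (m.degree : ℤ) + ((σ.1.card : ℤ) - c) = j :=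
      hφgr.map_mem_gradedFree c j hf σ m hm
    rw [σ.2.2] at h1
    change (m.degree : ℤ) + ((i + 1 : ℕ) : ℤ) = c + j
    linarith
  · intro q
    obtain ⟨z, rfl⟩ := Submodule.Quotient.mk_surjective _ q
    have hz : koszulD k Δ i z.1 = 0 := z.2
    obtain ⟨g, hg, hgz⟩ := exists_fullD_eq (z := extend k Δ (i + 1) z.1)
      (by rw [fullD_extend, hz, map_zero]) (extend_mem_cardSupported _)
    -- The missing-face part of `g` represents the class of `z`; the face part changes `z` only by a
    -- boundary of `Δ`.
    refine ⟨res' g, (Submodule.Quotient.eq _).2 (Submodule.mem_comap.2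
      ⟨-restrict k Δ (i + 2) g, hinjext (i + 1) ?_⟩)⟩
    have h2 := congrArg (fullD k n) (hdecomp g hg)
    rw [hgz, map_add, ← hφext] at h2
    rw [← fullD_extend, map_neg, map_neg]
    change _ = extend k Δ (i + 1) (φ (res' g) - z.1)
    rw [map_sub, h2]
    abel
  · rintro _ ⟨π, -, rfl⟩
    exact mem_idealOfVars_smul_top fun t => coeff_zero_fullD _ (s t)
  · intro t
    have := hscard t
    change (s t).card + 2 ≤ n
    omega
  · intro t
    have := hτ t
    change (τ t).card + 1 ≤ n
    omega

end Comparison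

end KoszulSimplicial

end

theorem proposition6p3 (k : Type*) [Field k] [CharZero k] (n : ℕ) :
    (∀ (d : ℕ) (Δ : AbstractSimplicialComplex (Fin n)), 1 ≤ d → d + 3 ≤ n →
      KoszulSimplicial.HasDimension Δ d → KoszulSimplicial.HasCompleteSkeleton Δ d →
      KoszulSimplicial.regularity n (KoszulSimplicial.koszulGrading k Δ d) ≤ ((n : ℝ) - 2 : ℝ)) ∧
    (4 ≤ n → ∀ Γ : SimpleGraph (Fin n),
      KoszulSimplicial.regularity n
          (KoszulSimplicial.shift
            (KoszulSimplicial.koszulGrading k (KoszulSimplicial.graphComplex Γ) 1) 2) ≤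
        ((n : ℝ) - 4 : ℝ)) := by
  constructor
  · intro d Δ hd hdn _ hΔ
    obtain ⟨i, rfl⟩ : ∃ i, d = i + 1 := ⟨d - 1, by omega⟩
    have h := KoszulSimplicial.regularity_koszulModule_le (k := k) (Δ := Δ) (i := i)
      (fun σ hσ => Or.inr (hΔ σ (Finset.card_pos.1 (by omega)) hσ.le)) (by omega) 0
    -- The general bound is stated for shifted gradings; here the shift is trivial.
    have e : KoszulSimplicial.shift (KoszulSimplicial.koszulGrading k Δ (i + 1)) 0 =
        KoszulSimplicial.koszulGrading k Δ (i + 1) :=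
      funext fun j => by rw [KoszulSimplicial.shift, zero_add]
    rw [e] at h
    refine h.trans_eq ?_
    push_cast
    simp
  · intro hn Γ
    refine (KoszulSimplicial.regularity_koszulModule_le (k := k) (i := 0) (fun σ hσ => Or.inr ?_)
      (by omega) 2).trans_eq ?_
    · obtain ⟨v, rfl⟩ := Finset.card_eq_one.1 hσ
      exact Or.inl ⟨v, rfl⟩
    · congr 1
      push_cast
      ring
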